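/- Let $n,d$ be integers with $2\le d\le n-1$, let $K\subset\mathbb{R}^n$ be a convex body (a compact convex set with non-empty interior), and let $H\subset\mathbb{R}^n$ be a linear subspace of dimension $d$. Then there exists an orthonormal basis $w_1,\dots,w_d$ of $H$ such that $$|P_{H^\perp}K|\,|K|^{d-1}\;\ge\;\frac{\binom{n+d}{n}}{(2n)^d}\prod_{i=1}^d|P_{w_i^\perp}K|.$$ Here, for a linear subspace $W\subset\mathbb{R}^n$, $P_W$ denotes the orthogonal projection onto $W$, $W^\perp$ is the orthogonal complement of $W$, $w_i^\perp$ is the hyperplane through the origin orthogonal to $w_i$, $|K|$ is the $n$-dimensional Lebesgue measure of $K$, and $|P_WK|$ is the Lebesgue measure of $P_WK$ in the Euclidean space $W$, of dimension $\dim W$. -/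

import Mathlib

open MeasureTheory

noncomputable section

/-- `|P_W K|`: the Lebesgue measure, inside the subspace `W`, of the orthogonal projection of `K`
onto `W`. Lebesgue measure on `W` is the Haar measure of `W` giving measure one to the unit cube of
an orthonormal basis of `W`. This is, by definition, the volume
of `W` as a finite-dimensional real inner product space; it is written out explicitly so as not to be
confused with the restriction of the ambient Lebesgue measure to `W`. It does not depend on
the choice of the orthonormal basis. -/
def projectionVolume {n : ℕ} (W : Submodule ℝ (EuclideanSpace ℝ (Fin n)))
    (K : Set (EuclideanSpace ℝ (Fin n))) : ℝ :=
  ((stdOrthonormalBasis ℝ W).toBasis.addHaar).real (W.orthogonalProjectionOnto '' K)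

end

open scoped ENNReal Pointwise

/-! ### The Prékopa–Leindler and Brunn–Minkowski inequalities -/

/-! Let g(x) = |K ∩ (x + K)| be the covariogram. Cauchy–Schwarz over the shadow of K, applied to the
d-dimensional volumes of the slices of K parallel to H, gives |K|² ≤ |P_{H^⊥}K| ∫_H g
(`sq_volume_le_mul_lintegral_covariogram`).

To bound the integral, Brunn–Minkowski makes g^{1/n} lie above its chords from the origin, and its
slope at the origin is governed by the projection body norm N. Hence g ≤ |K| (1 - N/(n|K|))₊^n
(`covariogram_le_one_sub_pow`). Integrating over H produces a beta integral, hence the binomial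
coefficient, times the volume of the unit ball L of N restricted to H.

Finally, H has an orthonormal basis with |L| ∏ N(w_i) ≤ 2^d: take w₁ minimizing N on the unit
sphere, so that L lies in the slab |⟨x, w₁⟩| ≤ 1/N(w₁); its central section is its largest, and one
inducts in w₁^⊥.

N is defined as the supremum over t > 0 of |K \ (tx + K)|/t, which makes subadditivity elementary.
Of the identity N(u) = |P_{u^⊥}K| only the inequality ≥ is needed
(`volume_projection_le_projectionBodyNorm`). -/

theorem ENNReal.geom_mean_le_arith_mean {t : ℝ} (h0 : 0 < t) (h1 : t < 1) (a b : ℝ≥0∞) :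
    a ^ (1 - t) * b ^ t ≤ ENNReal.ofReal (1 - t) * a + ENNReal.ofReal t * b := by
  have h2 : 0 < 1 - t := by linarith
  by_cases ha : a = ∞
  · have : ENNReal.ofReal (1 - t) ≠ 0 := by simpa using h1
    simp [ha, ENNReal.mul_top this]
  by_cases hb : b = ∞
  · have : ENNReal.ofReal t ≠ 0 := by simpa using h0
    simp [hb, ENNReal.mul_top this]
  lift a to NNReal using ha
  lift b to NNReal using hb
  have := NNReal.geom_mean_le_arith_mean2_weighted ⟨1 - t, h2.le⟩ ⟨t, h0.le⟩ a b
    (Subtype.ext (sub_add_cancel 1 t))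
  rw [← ENNReal.coe_rpow_of_nonneg _ h2.le, ← ENNReal.coe_rpow_of_nonneg _ h0.le,
    ENNReal.ofReal_eq_coe_nnreal h2.le, ENNReal.ofReal_eq_coe_nnreal h0.le]
  exact_mod_cast this

/-- The Prékopa–Leindler inequality with weight `t` for the measure `μ`. -/
def PrekopaLeindler {E : Type*} [AddCommGroup E] [Module ℝ E] [MeasurableSpace E]
    (μ : Measure E) (t : ℝ) : Prop :=
  ∀ f g h : E → ℝ≥0∞, Measurable f → Measurable g → Measurable h →
    (∀ x y, f x ^ (1 - t) * g y ^ t ≤ h ((1 - t) • x + t • y)) →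
    (∫⁻ x, f x ∂μ) ^ (1 - t) * (∫⁻ x, g x ∂μ) ^ t ≤ ∫⁻ x, h x ∂μ

/-- The translates A + min B and max A + B both lie in C and meet at most in the point max A + min
B. -/
theorem Real.volume_add_le_of_isCompact {A B C : Set ℝ} (hA : IsCompact A) (hB : IsCompact B)
    (hA0 : A.Nonempty) (hB0 : B.Nonempty) (hC : ∀ x ∈ A, ∀ y ∈ B, x + y ∈ C) :
    volume A + volume B ≤ volume C := by
  obtain ⟨a, ha, hamax⟩ := hA.exists_isGreatest hA0
  obtain ⟨b, hb, hbmin⟩ := hB.exists_isLeast hB0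
  have h1 : volume ((fun x => x + b) '' A ∪ (fun y => a + y) '' B) ≤ volume C := by
    apply measure_mono
    rintro _ (⟨x, hx, rfl⟩ | ⟨y, hy, rfl⟩)
    · exact hC x hx b hb
    · exact hC a ha y hy
  have hmB : MeasurableSet ((fun y => a + y) '' B) :=
    (hB.image (continuous_const_add a)).measurableSet
  have h2 : AEDisjoint volume ((fun x => x + b) '' A) ((fun y => a + y) '' B) := by
    refine measure_mono_null (t := {a + b}) ?_ (by simp)
    rintro _ ⟨⟨x, hx, rfl⟩, ⟨y, hy, hxy⟩⟩
    have := hamax hx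
    have := hbmin hy
    simp only [Set.mem_singleton_iff] at *
    linarith
  rw [measure_union₀ hmB.nullMeasurableSet h2] at h1
  simpa [Set.image_add_left, Set.image_add_right] using h1

theorem Real.volume_add_le {A B C : Set ℝ} (hA : MeasurableSet A) (hB : MeasurableSet B)
    (hA0 : A.Nonempty) (hB0 : B.Nonempty) (hC : ∀ x ∈ A, ∀ y ∈ B, x + y ∈ C) :
    volume A + volume B ≤ volume C := by
  obtain ⟨a, ha⟩ := hA0
  obtain ⟨b, hb⟩ := hB0
  have key : ∀ S ⊆ A, IsCompact S → ∀ T ⊆ B, IsCompact T → volume S + volume T ≤ volume C := by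
    intro S hS hSc T hT hTc
    -- Adjoining a and b keeps the inner compact approximations nonempty.
    refine le_trans (add_le_add (measure_mono (Set.subset_insert a S))
      (measure_mono (Set.subset_insert b T)))
      (Real.volume_add_le_of_isCompact (hSc.insert a) (hTc.insert b) (by simp) (by simp) ?_)
    intro x hx y hy
    exact hC x (Set.insert_subset ha hS hx) y (Set.insert_subset hb hT hy)
  by_contra! hlt
  by_cases hA' : volume A = 0
  · rw [hA', zero_add] at hlt
    obtain ⟨T, hT, hTc, hlt'⟩ := hB.exists_lt_isCompact hlt
    have := key ∅ (by simp) isCompact_empty T hT hTc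
    simp at this
    exact absurd hlt' (not_lt.mpr this)
  by_cases hB' : volume B = 0
  · rw [hB', add_zero] at hlt
    obtain ⟨T, hT, hTc, hlt'⟩ := hA.exists_lt_isCompact hlt
    have := key T hT hTc ∅ (by simp) isCompact_empty
    simp at this
    exact absurd hlt' (not_lt.mpr this)
  obtain ⟨r, hr, s, hs, hrs⟩ := ENNReal.exists_lt_add_of_lt_add hlt hA' hB'
  obtain ⟨S, hS, hSc, h1⟩ := hA.exists_lt_isCompact hr
  obtain ⟨T, hT, hTc, h2⟩ := hB.exists_lt_isCompact hs
  exact absurd (hrs.trans (ENNReal.add_lt_add h1 h2)) (not_lt.mpr (key S hS hSc T hT hTc))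

theorem Real.volume_combo_le {t : ℝ} (h0 : 0 < t) (h1 : t < 1) {A B C : Set ℝ}
    (hA : MeasurableSet A) (hB : MeasurableSet B)
    (hA0 : A.Nonempty) (hB0 : B.Nonempty)
    (hC : ∀ x ∈ A, ∀ y ∈ B, (1 - t) • x + t • y ∈ C) :
    ENNReal.ofReal (1 - t) * volume A + ENNReal.ofReal t * volume B ≤ volume C := by
  have h2 : 0 < 1 - t := by linarith
  have := Real.volume_add_le (A := (1 - t) • A) (B := t • B) (C := C)
    (hA.const_smul₀ _) (hB.const_smul₀ _) hA0.smul_set hB0.smul_set (by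
      rintro _ ⟨x, hx, rfl⟩ _ ⟨y, hy, rfl⟩
      exact hC x hx y hy)
  simpa [Measure.addHaar_smul, abs_of_pos h0, abs_of_pos h2] using this

theorem lintegral_eq_lintegral_meas_ofReal_lt {f : ℝ → ℝ≥0∞} (hf : Measurable f)
    (hf1 : ∀ x, f x ≤ 1) :
    ∫⁻ x, f x = ∫⁻ s in Set.Ioi (0 : ℝ), volume {x | ENNReal.ofReal s < f x} := by
  have hfin : ∀ x, f x ≠ ∞ := fun x => ne_top_of_le_ne_top ENNReal.one_ne_top (hf1 x)
  have := lintegral_eq_lintegral_meas_lt (f := fun x => (f x).toReal) volume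
    (Filter.Eventually.of_forall fun x => ENNReal.toReal_nonneg) hf.ennreal_toReal.aemeasurable
  simp only [ENNReal.ofReal_toReal (hfin _)] at this
  rw [this]
  refine setLIntegral_congr_fun measurableSet_Ioi fun s hs => ?_
  simp only [ENNReal.ofReal_lt_iff_lt_toReal (le_of_lt hs) (hfin _)]

/-- With both suprema equal to 1, the superlevel sets of f and g are nonempty for exactly the same
levels s < 1. One-dimensional Brunn–Minkowski then applies level by level, and the layer-cake
formula integrates it. -/
theorem lintegral_combo_le_of_iSup_eq_one {t : ℝ} (h0 : 0 < t) (h1 : t < 1)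
    {f g h : ℝ → ℝ≥0∞} (hf : Measurable f) (hg : Measurable g) (hh : Measurable h)
    (hf1 : ⨆ x, f x = 1) (hg1 : ⨆ x, g x = 1)
    (H : ∀ x y, f x ^ (1 - t) * g y ^ t ≤ h ((1 - t) • x + t • y)) :
    ENNReal.ofReal (1 - t) * (∫⁻ x, f x) + ENNReal.ofReal t * (∫⁻ x, g x) ≤ ∫⁻ x, h x := by
  have h2 : 0 < 1 - t := by linarith
  have hfle : ∀ x, f x ≤ 1 := fun x => hf1 ▸ le_iSup f x
  have hgle : ∀ x, g x ≤ 1 := fun x => hg1 ▸ le_iSup g x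
  refine le_trans ?_ (lintegral_mono (f := fun x => min (h x) 1) fun x => min_le_left _ _)
  rw [lintegral_eq_lintegral_meas_ofReal_lt hf hfle, lintegral_eq_lintegral_meas_ofReal_lt hg hgle,
    lintegral_eq_lintegral_meas_ofReal_lt (hh.min measurable_const) fun x => min_le_right _ _]
  have hanti : ∀ f : ℝ → ℝ≥0∞, Measurable fun s : ℝ => volume {x | ENNReal.ofReal s < f x} := by
    intro f
    apply Antitone.measurable
    intro r s hrs
    exact measure_mono fun x hx => lt_of_le_of_lt (ENNReal.ofReal_le_ofReal hrs) hx
  rw [← lintegral_const_mul _ (hanti f), ← lintegral_const_mul _ (hanti g),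
    ← lintegral_add_left ((hanti f).const_mul _)]
  refine setLIntegral_mono' measurableSet_Ioi fun s hs => ?_
  rcases lt_or_ge s 1 with hs1 | hs1
  · have hs1' : ENNReal.ofReal s < 1 := by simpa using hs1
    apply Real.volume_combo_le h0 h1 (measurableSet_lt measurable_const hf)
      (measurableSet_lt measurable_const hg)
    · exact lt_iSup_iff.mp (hf1 ▸ hs1')
    · exact lt_iSup_iff.mp (hg1 ▸ hs1')
    · intro x hx y hy
      simp only [Set.mem_ofPred_eq] at *
      refine lt_min (lt_of_lt_of_le ?_ (H x y)) hs1'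
      have hs0 : ENNReal.ofReal s ≠ 0 := by simpa using hs
      calc ENNReal.ofReal s = ENNReal.ofReal s ^ (1 - t) * ENNReal.ofReal s ^ t := by
            rw [← ENNReal.rpow_add _ _ hs0 ENNReal.ofReal_ne_top]; simp
        _ < _ := ENNReal.mul_lt_mul (ENNReal.rpow_lt_rpow hx h2) (ENNReal.rpow_lt_rpow hy h0)
  · have hs1' : 1 ≤ ENNReal.ofReal s := by simpa using hs1
    have : ∀ f : ℝ → ℝ≥0∞, (∀ x, f x ≤ 1) → volume {x | ENNReal.ofReal s < f x} = 0 := by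
      intro f hf
      convert measure_empty (μ := (volume : Measure ℝ))
      ext x
      simpa using (hf x).trans hs1'
    simp [this f hfle, this g hgle]

/-- Homogeneity: divide f and g by their suprema a and b, and h by a^(1-t) b^t. The normalized
additive inequality and AM–GM give the multiplicative one. -/
theorem prekopaLeindler_real_of_bounded {t : ℝ} (h0 : 0 < t) (h1 : t < 1)
    {f g h : ℝ → ℝ≥0∞} (hf : Measurable f) (hg : Measurable g) (hh : Measurable h)
    (hf1 : ⨆ x, f x ≠ ∞) (hg1 : ⨆ x, g x ≠ ∞)
    (H : ∀ x y, f x ^ (1 - t) * g y ^ t ≤ h ((1 - t) • x + t • y)) :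
    (∫⁻ x, f x) ^ (1 - t) * (∫⁻ x, g x) ^ t ≤ ∫⁻ x, h x := by
  have h2 : 0 < 1 - t := by linarith
  set a := ⨆ x, f x with ha
  set b := ⨆ x, g x with hb
  by_cases ha0 : a = 0
  · have : ∀ x, f x = 0 := by simpa [ha] using ha0
    simp [this, ENNReal.zero_rpow_of_pos h2]
  by_cases hb0 : b = 0
  · have : ∀ x, g x = 0 := by simpa [hb] using hb0
    simp [this, ENNReal.zero_rpow_of_pos h0]
  set c := a ^ (1 - t) * b ^ t with hc
  have hc0 : c ≠ 0 := by
    simp [hc, ENNReal.rpow_eq_zero_iff, ha0, hb0, hf1, hg1]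
  have hct : c ≠ ∞ := ENNReal.mul_ne_top (ENNReal.rpow_ne_top_of_nonneg h2.le hf1)
    (ENNReal.rpow_ne_top_of_nonneg h0.le hg1)
  have hcinv : (a⁻¹) ^ (1 - t) * (b⁻¹) ^ t = c⁻¹ := by
    rw [hc, ENNReal.mul_inv (by simp [ENNReal.rpow_eq_zero_iff, ha0, hf1]) (by
      simp [ENNReal.rpow_eq_zero_iff, hb0, hg1])]
    rw [ENNReal.inv_rpow, ENNReal.inv_rpow]
  have key := lintegral_combo_le_of_iSup_eq_one h0 h1 (f := fun x => a⁻¹ * f x)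
    (g := fun x => b⁻¹ * g x) (h := fun x => c⁻¹ * h x) (hf.const_mul _) (hg.const_mul _)
    (hh.const_mul _) (by rw [← ENNReal.mul_iSup, ENNReal.inv_mul_cancel ha0 hf1])
    (by rw [← ENNReal.mul_iSup, ENNReal.inv_mul_cancel hb0 hg1]) (by
      intro x y
      rw [ENNReal.mul_rpow_of_nonneg _ _ h2.le, ENNReal.mul_rpow_of_nonneg _ _ h0.le,
        mul_mul_mul_comm, hcinv]
      exact mul_le_mul_right (H x y) _)
  have key2 := (ENNReal.geom_mean_le_arith_mean h0 h1 _ _).trans key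
  rw [lintegral_const_mul _ hf, lintegral_const_mul _ hg, lintegral_const_mul _ hh,
    ENNReal.mul_rpow_of_nonneg _ _ h2.le, ENNReal.mul_rpow_of_nonneg _ _ h0.le,
        mul_mul_mul_comm, hcinv] at key2
  exact (ENNReal.mul_le_mul_iff_right (by simpa using hct) (by simpa using hc0)).mp key2

theorem prekopaLeindler_real {t : ℝ} (h0 : 0 < t) (h1 : t < 1) :
    PrekopaLeindler (volume : Measure ℝ) t := by
  intro f g h hf hg hh H
  have h2 : 0 < 1 - t := by linarith
  -- Zero integrals are set aside so that the limit of products below never has the form 0 · ∞.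
  by_cases hf0 : ∫⁻ x, f x = 0
  · simp [hf0, ENNReal.zero_rpow_of_pos h2]
  by_cases hg0 : ∫⁻ x, g x = 0
  · simp [hg0, ENNReal.zero_rpow_of_pos h0]
  have lim : ∀ f : ℝ → ℝ≥0∞, Measurable f → Filter.Tendsto
      (fun N : ℕ => ∫⁻ x, min (f x) N) Filter.atTop (nhds (∫⁻ x, f x)) := by
    intro f hf
    refine lintegral_tendsto_of_tendsto_of_monotone
      (fun N => (hf.min measurable_const).aemeasurable) ?_ ?_
    · refine Filter.Eventually.of_forall fun x m n hmn => ?_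
      exact min_le_min_left _ (by exact_mod_cast hmn)
    · refine Filter.Eventually.of_forall fun x => ?_
      have := (tendsto_const_nhds (x := f x)).min ENNReal.tendsto_nat_nhds_top
      simpa using this
  have bd : ∀ (f : ℝ → ℝ≥0∞) (N : ℕ), ⨆ x, min (f x) N ≠ ∞ := fun f N =>
    ne_top_of_le_ne_top (ENNReal.natCast_ne_top N) (iSup_le fun x => min_le_right _ _)
  refine le_of_tendsto (ENNReal.Tendsto.mul (((lim f hf).ennrpow_const (1 - t)))
    (Or.inl ?_) ((lim g hg).ennrpow_const t) (Or.inl ?_))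
    (Filter.Eventually.of_forall fun N => prekopaLeindler_real_of_bounded h0 h1
      (hf.min measurable_const) (hg.min measurable_const) hh (bd f N) (bd g N) fun x y => ?_)
  · simp [ENNReal.rpow_eq_zero_iff, hf0, h1.le]
  · simp [ENNReal.rpow_eq_zero_iff, hg0, h0.le]
  · refine le_trans (mul_le_mul' (ENNReal.rpow_le_rpow (min_le_left _ _) h2.le)
      (ENNReal.rpow_le_rpow (min_le_left _ _) h0.le)) (H x y)

/-- The inequality tensorizes: applied in F to the slices over x, y and (1-t)x + ty, it yields for
the inner integrals exactly the hypothesis required in E. -/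
theorem PrekopaLeindler.prod {E F : Type*} [AddCommGroup E] [Module ℝ E] [MeasurableSpace E]
    [AddCommGroup F] [Module ℝ F] [MeasurableSpace F] {μ : Measure E} {ν : Measure F} [SFinite ν]
    {t : ℝ} (hE : PrekopaLeindler μ t) (hF : PrekopaLeindler ν t) :
    PrekopaLeindler (μ.prod ν) t := by
  intro f g h hf hg hh H
  rw [lintegral_prod _ hf.aemeasurable, lintegral_prod _ hg.aemeasurable,
    lintegral_prod _ hh.aemeasurable]
  refine hE _ _ _ hf.lintegral_prod_right' hg.lintegral_prod_right' hh.lintegral_prod_right' ?_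
  intro x y
  exact hF _ _ _ (hf.comp measurable_prodMk_left) (hg.comp measurable_prodMk_left)
    (hh.comp measurable_prodMk_left) fun x' y' => H (x, x') (y, y')

theorem PrekopaLeindler.of_linearEquiv {E F : Type*} [AddCommGroup E] [Module ℝ E]
    [MeasurableSpace E] [AddCommGroup F] [Module ℝ F] [MeasurableSpace F] {μ : Measure E}
    {ν : Measure F} {t : ℝ} (hE : PrekopaLeindler μ t) (e : E →ₗ[ℝ] F)
    (he : MeasurePreserving e μ ν) : PrekopaLeindler ν t := by
  intro f g h hf hg hh H
  rw [← he.lintegral_comp hf, ← he.lintegral_comp hg, ← he.lintegral_comp hh]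
  refine hE _ _ _ (hf.comp he.measurable) (hg.comp he.measurable) (hh.comp he.measurable) ?_
  intro x y
  simpa using H (e x) (e y)

theorem prekopaLeindler_pi {t : ℝ} (h0 : 0 < t) (h1 : t < 1) (n : ℕ) :
    PrekopaLeindler (volume : Measure (Fin n → ℝ)) t := by
  induction n with
  | zero =>
    intro f g h hf hg hh H
    rw [Measure.volume_pi_eq_dirac 0, lintegral_dirac, lintegral_dirac, lintegral_dirac]
    simpa using H 0 0
  | succ n ih =>
    refine ((prekopaLeindler_real h0 h1).prod ih).of_linearEquiv
      (Fin.consLinearEquiv ℝ fun _ : Fin (n + 1) => ℝ).toLinearMap ?_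
    have e : ((Fin.consLinearEquiv ℝ fun _ : Fin (n + 1) => ℝ).toLinearMap :
        ℝ × (Fin n → ℝ) → Fin (n + 1) → ℝ) =
        (MeasurableEquiv.piFinSuccAbove (fun _ : Fin (n + 1) => ℝ) 0).symm := by
      funext p
      simp [MeasurableEquiv.piFinSuccAbove, Fin.insertNthEquiv]
      rfl
    rw [e]
    exact (volume_preserving_piFinSuccAbove (fun _ : Fin (n + 1) => ℝ) 0).symm

theorem prekopaLeindler_volume {E : Type*} [NormedAddCommGroup E] [InnerProductSpace ℝ E]
    [FiniteDimensional ℝ E] [MeasurableSpace E] [BorelSpace E] {t : ℝ} (h0 : 0 < t) (h1 : t < 1) :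
    PrekopaLeindler (volume : Measure E) t := by
  refine (prekopaLeindler_pi h0 h1 (Module.finrank ℝ E)).of_linearEquiv
    ((stdOrthonormalBasis ℝ E).repr.symm.toLinearEquiv.toLinearMap ∘ₗ
      (WithLp.linearEquiv 2 ℝ (Fin (Module.finrank ℝ E) → ℝ)).symm.toLinearMap) ?_
  exact (stdOrthonormalBasis ℝ E).measurePreserving_repr_symm.comp
    (PiLp.volume_preserving_toLp _)

section BrunnMinkowski

variable {E : Type*} [NormedAddCommGroup E] [InnerProductSpace ℝ E]
    [FiniteDimensional ℝ E] [MeasurableSpace E] [BorelSpace E]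

theorem volume_rpow_mul_le {t : ℝ} (h0 : 0 < t) (h1 : t < 1) {A B C : Set E}
    (hA : MeasurableSet A) (hB : MeasurableSet B) (hC : MeasurableSet C)
    (H : ∀ x ∈ A, ∀ y ∈ B, (1 - t) • x + t • y ∈ C) :
    volume A ^ (1 - t) * volume B ^ t ≤ volume C := by
  have h2 : 0 < 1 - t := by linarith
  have := prekopaLeindler_volume h0 h1 (E := E) (A.indicator 1) (B.indicator 1) (C.indicator 1)
    (measurable_one.indicator hA) (measurable_one.indicator hB) (measurable_one.indicator hC) (by
      intro x y
      by_cases hx : x ∈ A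
      · by_cases hy : y ∈ B
        · simp [hx, hy, H x hx y hy]
        · simp [hy, ENNReal.zero_rpow_of_pos h0]
      · simp [hx, ENNReal.zero_rpow_of_pos h2])
  simpa [lintegral_indicator_one, hA, hB, hC] using this

/-- The Brunn–Minkowski inequality, in terms of the `n`-th roots `α`, `β` of the volumes. -/
theorem brunnMinkowski {a b α β : ℝ} (ha : 0 < a) (hb : 0 < b) (hα : 0 < α) (hβ : 0 ≤ β)
    {A B C : Set E} (hA : MeasurableSet A) (hB : MeasurableSet B) (hC : MeasurableSet C)
    (hB0 : B.Nonempty)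
    (hAα : volume A = ENNReal.ofReal (α ^ Module.finrank ℝ E))
    (hBβ : volume B = ENNReal.ofReal (β ^ Module.finrank ℝ E))
    (H : ∀ x ∈ A, ∀ y ∈ B, a • x + b • y ∈ C) :
    ENNReal.ofReal ((a * α + b * β) ^ Module.finrank ℝ E) ≤ volume C := by
  rcases hβ.eq_or_lt with rfl | hβ
  · obtain ⟨y, hy⟩ := hB0
    have h1 : (fun x => b • y + x) '' (a • A) ⊆ C := by
      rintro _ ⟨_, ⟨x, hx, rfl⟩, rfl⟩
      simpa [add_comm] using H x hx y hy
    have h2 := measure_mono (μ := volume) h1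
    rw [Set.image_add_left, measure_preimage_add, Measure.addHaar_smul, hAα,
      ← ENNReal.ofReal_mul (abs_nonneg _), abs_of_pos (by positivity), ← mul_pow] at h2
    simpa using h2
  · set s := a * α + b * β with hs
    have hs0 : 0 < s := by positivity
    have hsc : ∀ {α : ℝ} {A : Set E}, 0 < α → volume A = ENNReal.ofReal (α ^ Module.finrank ℝ E) →
        volume (α⁻¹ • A) = 1 := by
      intro α A hα hA
      rw [Measure.addHaar_smul, hA, ← ENNReal.ofReal_mul (abs_nonneg _),
        abs_of_pos (by positivity), ← mul_pow, inv_mul_cancel₀ hα.ne']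
      simp
    -- A/α and B/β have volume one, and combining them with weights aα/s and bβ/s lands in C/s. The
    -- multiplicative inequality then says that |C/s| ≥ 1.
    have key := volume_rpow_mul_le (t := b * β / s) (by positivity)
      (by rw [div_lt_one hs0]; nlinarith [mul_pos ha hα]) (hA.const_smul₀ α⁻¹) (hB.const_smul₀ β⁻¹)
      (hC.const_smul₀ s⁻¹) (by
        rintro _ ⟨x, hx, rfl⟩ _ ⟨y, hy, rfl⟩
        refine ⟨_, H x hx y hy, ?_⟩
        have e1 : 1 - b * β / s = s⁻¹ * (a * α) := by
          field_simp
          rw [hs]; ring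
        simp only [smul_add, smul_smul, e1]
        congr 2
        · field_simp
        · field_simp)
    rw [hsc hα hAα, hsc hβ hBβ, ENNReal.one_rpow, ENNReal.one_rpow, one_mul,
      Measure.addHaar_smul, abs_of_pos (by positivity), inv_pow, ENNReal.ofReal_inv_of_pos
      (by positivity)] at key
    rwa [← ENNReal.div_eq_inv_mul, ENNReal.le_div_iff_mul_le
      (Or.inl (by simpa using by positivity)) (by simp), one_mul] at key

end BrunnMinkowski

/-! ### Orthogonal decompositions of the volume -/

section Decomposition

variable {E : Type*} [NormedAddCommGroup E] [InnerProductSpace ℝ E]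
    [FiniteDimensional ℝ E] [MeasurableSpace E] [BorelSpace E]

theorem Submodule.measurePreserving_add_orthogonal (W : Submodule ℝ E) :
    MeasurePreserving (fun p : W × Wᗮ => (p.1 : E) + p.2) volume volume :=
  (LinearIsometryEquiv.measurePreserving W.orthogonalDecomposition.symm).comp
    (WithLp.volume_preserving_toLp W Wᗮ)

theorem measurePreserving_smul_add_orthogonal {u : E} (hu : ‖u‖ = 1) :
    MeasurePreserving (fun p : ℝ × (Submodule.span ℝ {u})ᗮ => p.1 • u + (p.2 : E))
      volume volume :=
  (Submodule.span ℝ {u}).measurePreserving_add_orthogonal.comp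
    ((LinearIsometryEquiv.toSpanUnitSingleton (𝕜 := ℝ) u hu).measurePreserving.prod
      (MeasurePreserving.id volume))

end Decomposition

/-! ### Unit balls of norms and orthonormal bases -/

section UnitBall

theorem Seminorm.continuous_of_finiteDimensional {E : Type*} [NormedAddCommGroup E]
    [NormedSpace ℝ E] [FiniteDimensional ℝ E] (N : Seminorm ℝ E) : Continuous N :=
  continuousOn_univ.mp (N.convexOn.continuousOn isOpen_univ)

/-- The volume of a symmetric convex body is at most its width times the area of its central
section. -/
theorem Seminorm.volume_unitBall_le_of_isMinOn {E : Type*} [NormedAddCommGroup E]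
    [InnerProductSpace ℝ E] [FiniteDimensional ℝ E] [MeasurableSpace E] [BorelSpace E]
    (N : Seminorm ℝ E) {w : E} (hw : ‖w‖ = 1) (hNw : 0 < N w)
    (hmin : ∀ x : E, N w * ‖x‖ ≤ N x) :
    volume {x | N x ≤ 1} ≤ ENNReal.ofReal (2 / N w) *
      volume {y : (Submodule.span ℝ {w})ᗮ | N (y : E) ≤ 1} := by
  set W := (Submodule.span ℝ {w})ᗮ
  have hNc := N.continuous_of_finiteDimensional
  have hL : MeasurableSet {x | N x ≤ 1} := (isClosed_le hNc continuous_const).measurableSet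
  have hpre := (measurePreserving_smul_add_orthogonal hw)
  rw [← hpre.measure_preimage hL.nullMeasurableSet, Measure.volume_eq_prod,
    Measure.prod_apply (hpre.measurable hL)]
  set A : ℝ → Set W := fun s => {y : W | N (s • w + y) ≤ 1} with hA
  have hAm : ∀ s, MeasurableSet (A s) := fun s =>
    (isClosed_le (hNc.comp (by fun_prop)) continuous_const).measurableSet
  have h0 : A 0 = {y : W | N (y : E) ≤ 1} := by simp [hA]
  -- Sections at heights s and -s are reflections of each other, and their midpoints lie in the
  -- central section.
  have hsec : ∀ s, volume (A s) ≤ volume (A 0) := by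
    intro s
    have hneg : volume (A (-s)) = volume (A s) := by
      rw [← Measure.measure_neg volume (A s)]
      congr 1
      ext y
      simp only [hA, Set.mem_ofPred_eq, Set.mem_neg]
      rw [← map_neg_eq_map N]
      simp [add_comm]
    have := volume_rpow_mul_le (t := 1 / 2) (by norm_num) (by norm_num) (hAm s) (hAm (-s)) (hAm 0)
      (by
        intro x hx y hy
        simp only [hA, Set.mem_ofPred_eq] at *
        have : (0 : ℝ) • w + (((1 - 1 / 2 : ℝ) • x + (1 / 2 : ℝ) • y : W) : E) =
            (1 / 2 : ℝ) • (s • w + x) + (1 / 2 : ℝ) • ((-s) • w + y) := by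
          push_cast
          module
        rw [this]
        refine (map_add_le_add N _ _).trans ?_
        rw [map_smul_eq_mul, map_smul_eq_mul, Real.norm_of_nonneg (by norm_num)]
        linarith)
    rw [hneg] at this
    by_cases hs0 : volume (A s) = 0
    · simp [hs0]
    by_cases hst : volume (A s) = ∞
    · rw [hst] at this ⊢
      norm_num at this
      simpa [ENNReal.top_rpow_of_pos] using this
    rw [← ENNReal.rpow_add _ _ hs0 hst] at this
    simpa using this
  -- Minimality confines the ball to a slab: |s| ≤ ‖s w + y‖ ≤ N(s w + y) / N(w) ≤ 1 / N(w).
  have hempty : ∀ s, s ∉ Set.Icc (-(1 / N w)) (1 / N w) → A s = ∅ := by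
    intro s hs
    by_contra hne
    obtain ⟨y, hy⟩ := Set.nonempty_iff_ne_empty.mpr hne
    apply hs
    rw [Set.mem_Icc, ← abs_le, le_div_iff₀ hNw]
    have h1 : |s| ≤ ‖s • w + (y : E)‖ := by
      have horth : inner ℝ w (y : E) = 0 :=
        Submodule.mem_orthogonal_singleton_iff_inner_right.mp y.2
      have h2 : inner ℝ w (s • w + (y : E)) = s := by
        rw [inner_add_right, horth, inner_smul_right, real_inner_self_eq_norm_sq, hw]
        simp
      calc |s| = |inner ℝ w (s • w + (y : E))| := by rw [h2]
        _ ≤ ‖w‖ * ‖s • w + (y : E)‖ := abs_real_inner_le_norm _ _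
        _ = _ := by rw [hw, one_mul]
    have h3 := hmin (s • w + (y : E))
    have h4 : N (s • w + (y : E)) ≤ 1 := hy
    nlinarith
  calc ∫⁻ s, volume (A s)
      ≤ ∫⁻ s, (Set.Icc (-(1 / N w)) (1 / N w)).indicator (fun _ => volume (A 0)) s := by
        refine lintegral_mono fun s => ?_
        by_cases hs : s ∈ Set.Icc (-(1 / N w)) (1 / N w)
        · rw [Set.indicator_of_mem hs]; exact hsec s
        · rw [hempty s hs]; simp
    _ = ENNReal.ofReal (2 / N w) * volume (A 0) := by
        rw [lintegral_indicator_const measurableSet_Icc, Real.volume_Icc, mul_comm]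
        congr 2
        ring
    _ = _ := by rw [h0]

/-- The unit ball of a norm has volume at most that of the cross-section boxes
`∏ 2 / N (w i)` for a suitable orthonormal basis `w`. -/
theorem Seminorm.exists_orthonormalBasis_volume_unitBall_mul_prod_le (d : ℕ) :
    ∀ {E : Type*} [NormedAddCommGroup E] [InnerProductSpace ℝ E] [FiniteDimensional ℝ E]
      [MeasurableSpace E] [BorelSpace E] (N : Seminorm ℝ E), (∀ x, x ≠ 0 → 0 < N x) →
      Module.finrank ℝ E = d →
      ∃ w : OrthonormalBasis (Fin d) ℝ E,
        volume {x | N x ≤ 1} * ∏ i, ENNReal.ofReal (N (w i)) ≤ 2 ^ d := by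
  induction d with
  | zero =>
    intro E _ _ _ _ _ N hN hE
    have hsub : Subsingleton E := Module.finrank_zero_iff.mp hE
    have b := (stdOrthonormalBasis ℝ E).reindex (finCongr hE)
    refine ⟨b, ?_⟩
    -- In dimension zero the space is a point, of volume one as the parallelepiped of the empty
    -- basis.
    have h1 := b.volume_parallelepiped
    have hne : (parallelepiped b).Nonempty := by
      by_contra h
      rw [Set.not_nonempty_iff_eq_empty.mp h] at h1
      simp at h1
    rw [Subsingleton.eq_univ_of_nonempty hne] at h1
    simpa using (measure_mono (Set.subset_univ _)).trans_eq h1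
  | succ d ih =>
    intro E _ _ _ _ _ N hN hE
    have hnt : Nontrivial E := Module.nontrivial_of_finrank_pos (R := ℝ) (by omega)
    -- The minimizer on the sphere is the first basis vector; slab width 2 / N(w) times N(w)
    -- contributes one factor 2.
    obtain ⟨w, hwS, hwmin⟩ := (isCompact_sphere (0 : E) 1).exists_isMinOn
      (NormedSpace.sphere_nonempty.mpr zero_le_one) N.continuous_of_finiteDimensional.continuousOn
    have hw : ‖w‖ = 1 := by simpa using hwS
    have hw0 : w ≠ 0 := by rintro rfl; simp at hw
    have hNw := hN w hw0
    have hmin : ∀ x : E, N w * ‖x‖ ≤ N x := by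
      intro x
      by_cases hx : x = 0
      · simp [hx]
      have hx' : 0 < ‖x‖ := norm_pos_iff.mpr hx
      have h1 := hwmin (show ‖x‖⁻¹ • x ∈ Metric.sphere (0 : E) 1 by simp [norm_smul, hx'.ne'])
      simp only [Set.mem_ofPred_eq, map_smul_eq_mul, norm_inv, norm_norm] at h1
      rwa [inv_mul_eq_div, le_div_iff₀ hx'] at h1
    set W := (Submodule.span ℝ {w})ᗮ with hWdef
    have hfr : Module.finrank ℝ W = d := by
      have h1 := (Submodule.span ℝ {w}).finrank_add_finrank_orthogonal
      rw [finrank_span_singleton hw0, hE, ← hWdef] at h1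
      omega
    obtain ⟨b, hb⟩ := ih (N.comp W.subtype) (fun x hx => hN _ (by simpa using hx)) hfr
    have horth : Orthonormal ℝ (Fin.cons w (fun i => (b i : E)) : Fin (d + 1) → E) := by
      have hbo := b.orthonormal
      refine ⟨?_, ?_⟩
      · intro i
        refine Fin.cases ?_ (fun i => ?_) i
        · simpa using hw
        · rw [Fin.cons_succ]
          exact hbo.1 i
      · intro i j
        have hwb : ∀ i, inner ℝ w (b i : E) = 0 := fun i =>
          Submodule.mem_orthogonal_singleton_iff_inner_right.mp (b i).2
        refine Fin.cases ?_ (fun i => ?_) i <;> refine Fin.cases ?_ (fun j => ?_) j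
        · simp
        · intro _
          simpa using hwb j
        · intro _
          simpa [real_inner_comm] using hwb i
        · intro hij
          simpa using hbo.2 (fun h => hij (by rw [h]) : i ≠ j)
    have hspan : ⊤ ≤ Submodule.span ℝ
        (Set.range (Fin.cons w (fun i => (b i : E)) : Fin (d + 1) → E)) :=
      (horth.linearIndependent.span_eq_top_of_card_eq_finrank (by simp [hE])).ge
    refine ⟨OrthonormalBasis.mk horth hspan, ?_⟩
    rw [OrthonormalBasis.coe_mk, Fin.prod_univ_succ]
    simp only [Fin.cons_zero, Fin.cons_succ]
    have hvol := N.volume_unitBall_le_of_isMinOn hw hNw hmin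
    calc volume {x | N x ≤ 1} * (ENNReal.ofReal (N w) * ∏ i, ENNReal.ofReal (N (b i : E)))
        ≤ (ENNReal.ofReal (2 / N w) * volume {y : W | N (y : E) ≤ 1}) *
          (ENNReal.ofReal (N w) * ∏ i, ENNReal.ofReal (N (b i : E))) := by gcongr
      _ = (ENNReal.ofReal (2 / N w) * ENNReal.ofReal (N w)) * (volume {y : W | N (y : E) ≤ 1} *
          ∏ i, ENNReal.ofReal (N (b i : E))) := by ring
      _ ≤ 2 * 2 ^ d := by
          refine mul_le_mul' ?_ hb
          rw [← ENNReal.ofReal_mul (by positivity), div_mul_cancel₀ _ hNw.ne']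
          simp
      _ = 2 ^ (d + 1) := by ring

end UnitBall

/-! ### Integrals of powers of `1 - N` for a seminorm `N` -/

section BetaIntegral

/-- The density of Beta(n, d + 1) has total mass one, and n B(n, d + 1) = n! d! / (n + d)!. -/
theorem lintegral_Ioo_mul_pow_mul_one_sub_pow {n : ℕ} (hn : 0 < n) (d : ℕ) :
    ∫⁻ t in Set.Ioo (0 : ℝ) 1, ENNReal.ofReal (n * t ^ (n - 1) * (1 - t) ^ d) =
      ENNReal.ofReal (1 / (n + d).choose n) := by
  have hn' : (0 : ℝ) < n := by exact_mod_cast hn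
  have hd' : (0 : ℝ) < (d : ℝ) + 1 := by positivity
  have h1 := ProbabilityTheory.lintegral_betaPDF_eq_one hn' hd'
  rw [ProbabilityTheory.lintegral_betaPDF] at h1
  set B := ProbabilityTheory.beta (n : ℝ) ((d : ℝ) + 1) with hB
  have hB0 : 0 < B := ProbabilityTheory.beta_pos hn' hd'
  have hval : n * B = 1 / (n + d).choose n := by
    obtain ⟨m, rfl⟩ : ∃ m, n = m + 1 := ⟨n - 1, by omega⟩
    rw [hB, ProbabilityTheory.beta, show ((m + 1 : ℕ) : ℝ) + ((d : ℝ) + 1) =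
      ((m + 1 + d : ℕ) : ℝ) + 1 by push_cast; ring, Real.Gamma_nat_eq_factorial,
      Real.Gamma_nat_eq_factorial, Nat.cast_add_one m, Real.Gamma_nat_eq_factorial,
      Nat.cast_add_choose, Nat.factorial_succ m]
    have := Nat.factorial_pos m
    have := Nat.factorial_pos d
    have := Nat.factorial_pos (m + 1 + d)
    push_cast
    field_simp
  rw [← hval, ← mul_one (ENNReal.ofReal (n * B)), ← h1,
    ← lintegral_const_mul' _ _ ENNReal.ofReal_ne_top]
  refine setLIntegral_congr_fun measurableSet_Ioo fun t ht => ?_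
  rw [← ENNReal.ofReal_mul (by positivity)]
  congr 1
  have e1 : t ^ ((n : ℝ) - 1) = t ^ (n - 1) := by
    rw [← Nat.cast_pred hn, Real.rpow_natCast]
  rw [e1, add_sub_cancel_right, Real.rpow_natCast]
  field_simp

variable {E : Type*} [NormedAddCommGroup E] [InnerProductSpace ℝ E]
    [FiniteDimensional ℝ E] [MeasurableSpace E] [BorelSpace E]

theorem Seminorm.volume_le_eq (N : Seminorm ℝ E) {r : ℝ} (hr : 0 < r) :
    volume {x | N x ≤ r} = ENNReal.ofReal (r ^ Module.finrank ℝ E) * volume {x | N x ≤ 1} := by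
  rw [← abs_of_pos (show 0 < r ^ Module.finrank ℝ E by positivity), ← Measure.addHaar_smul]
  congr 1
  ext x
  rw [Set.mem_smul_set_iff_inv_smul_mem₀ hr.ne']
  simp only [Set.mem_ofPred_eq, map_smul_eq_mul, norm_inv, Real.norm_of_nonneg hr.le]
  rw [inv_mul_le_iff₀ hr, mul_one]

/-- By the layer-cake formula the integral is that of n t^(n-1) |{1 - N/M > t}| over 0 < t < 1. The
level set lies in the ball of radius M(1 - t), whose volume scales as (M(1 - t))^d. -/
theorem Seminorm.lintegral_one_sub_pow_le (N : Seminorm ℝ E) {M : ℝ} (hM : 0 < M) {n : ℕ}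
    (hn : 0 < n) :
    ∫⁻ x, ENNReal.ofReal (max 0 (1 - N x / M) ^ n) ≤
      ENNReal.ofReal (M ^ Module.finrank ℝ E / (n + Module.finrank ℝ E).choose n) *
        volume {x | N x ≤ 1} := by
  set d := Module.finrank ℝ E
  have hNc := N.continuous_of_finiteDimensional
  have hint : ∀ y : ℝ, ∫ t in 0..y, (n : ℝ) * t ^ (n - 1) = y ^ n := by
    intro y
    rw [intervalIntegral.integral_const_mul, integral_pow, Nat.sub_add_cancel hn, Nat.cast_pred hn]
    have : (n : ℝ) ≠ 0 := by positivity
    field_simp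
    simp [hn.ne']
  have h1 := lintegral_comp_eq_lintegral_meas_lt_mul (volume : Measure E)
    (f := fun x => max 0 (1 - N x / M)) (g := fun t => n * t ^ (n - 1))
    (Filter.Eventually.of_forall fun x => le_max_left _ _)
    (by fun_prop) (fun t _ => (by fun_prop : Continuous fun t : ℝ =>
      (n : ℝ) * t ^ (n - 1)).intervalIntegrable _ _)
    (ae_restrict_of_forall_mem measurableSet_Ioi fun t (ht : 0 < t) => by positivity)
  simp only [hint] at h1
  rw [h1]
  calc ∫⁻ t in Set.Ioi (0 : ℝ), volume {x | t < max 0 (1 - N x / M)} *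
        ENNReal.ofReal (n * t ^ (n - 1))
      ≤ ∫⁻ t in Set.Ioi (0 : ℝ), (Set.Ioo (0 : ℝ) 1).indicator (fun t =>
          ENNReal.ofReal (n * t ^ (n - 1) * (1 - t) ^ d) *
          (ENNReal.ofReal (M ^ d) * volume {x | N x ≤ 1})) t := by
        refine setLIntegral_mono' measurableSet_Ioi fun t (ht : 0 < t) => ?_
        rcases lt_or_ge t 1 with ht1 | ht1
        · rw [Set.indicator_of_mem (show t ∈ Set.Ioo (0 : ℝ) 1 from ⟨ht, ht1⟩)]
          have h1t : 0 < 1 - t := by linarith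
          have hsub : {x | t < max 0 (1 - N x / M)} ⊆ {x | N x ≤ M * (1 - t)} := by
            intro x hx
            simp only [Set.mem_ofPred_eq, lt_max_iff] at *
            rcases hx with hx | hx
            · linarith
            · have : N x / M < 1 - t := by linarith
              rw [div_lt_iff₀ hM] at this
              linarith
          calc _ ≤ volume {x | N x ≤ M * (1 - t)} * ENNReal.ofReal (n * t ^ (n - 1)) := by
                gcongr
            _ = _ := by
                rw [N.volume_le_eq (by positivity), mul_pow, ENNReal.ofReal_mul (by positivity),
                  ENNReal.ofReal_mul (p := n * t ^ (n - 1)) (by positivity)]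
                ring
        · have : {x | t < max 0 (1 - N x / M)} = ∅ := by
            ext x
            have : 0 ≤ N x / M := by positivity
            simp only [Set.mem_ofPred_eq, lt_max_iff, Set.mem_empty_iff_false, iff_false]
            rintro (hx | hx) <;> linarith
          rw [this]
          simp
    _ = (∫⁻ t in Set.Ioo (0 : ℝ) 1, ENNReal.ofReal (n * t ^ (n - 1) * (1 - t) ^ d)) *
          (ENNReal.ofReal (M ^ d) * volume {x | N x ≤ 1}) := by
        rw [lintegral_indicator measurableSet_Ioo, Measure.restrict_restrict measurableSet_Ioo,
          Set.inter_eq_left.mpr Set.Ioo_subset_Ioi_self, lintegral_mul_const _ (by fun_prop)]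
    _ = _ := by
        rw [lintegral_Ioo_mul_pow_mul_one_sub_pow hn, ← mul_assoc, ← ENNReal.ofReal_mul
          (by positivity)]
        congr 2
        ring

end BetaIntegral

noncomputable section

/-! ### The covariogram and the projection body norm -/

section Covariogram

theorem measurableSet_inter_translate {E : Type*} [NormedAddCommGroup E] [MeasurableSpace E]
    [BorelSpace E] {K : Set E} (hK : IsCompact K) (x : E) :
    MeasurableSet {y | y ∈ K ∧ y - x ∈ K} :=
  hK.measurableSet.inter (hK.measurableSet.preimage (measurable_sub_const x))

/-- An interior point stays in K under a small shift. This gives each ray a base point for the chord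
estimate, so that the supremum defining `projectionBodyNorm` is finite. -/
theorem exists_smul_translate_inter_nonempty {E : Type*} [NormedAddCommGroup E]
    [NormedSpace ℝ E] {K : Set E} (hint : (interior K).Nonempty) (x : E) :
    ∃ s : ℝ, 0 < s ∧ {y | y ∈ K ∧ y - s • x ∈ K}.Nonempty := by
  obtain ⟨c, hc⟩ := hint
  have h1 : Filter.Tendsto (fun s : ℝ => c - s • x) (nhdsWithin 0 (Set.Ioi 0)) (nhds c) := by
    have : Continuous fun s : ℝ => c - s • x := by fun_prop
    simpa using (this.tendsto 0).mono_left nhdsWithin_le_nhds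
  obtain ⟨s, hs, hs0⟩ := ((h1.eventually (mem_interior_iff_mem_nhds.mp hc)).and
    self_mem_nhdsWithin).exists
  exact ⟨s, hs0, c, interior_subset hc, hs⟩

variable {E : Type*} [NormedAddCommGroup E] [InnerProductSpace ℝ E]
    [FiniteDimensional ℝ E] [MeasurableSpace E] [BorelSpace E]

/-- The covariogram `|K ∩ (x + K)|`. -/
def covariogram (K : Set E) (x : E) : ℝ := volume.real {y | y ∈ K ∧ y - x ∈ K}

/-- The volume of `K \ (x + K)`. -/
def covariogramDefect (K : Set E) (x : E) : ℝ := volume.real {y | y ∈ K ∧ y - x ∉ K}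

/-- The projection body norm of `K`: the value at a unit vector `u` is the volume of the projection
of `K` to the orthogonal hyperplane of `u`, for a convex body `K`. -/
def projectionBodyNorm (K : Set E) (x : E) : ℝ :=
  ⨆ t : Set.Ioi (0 : ℝ), covariogramDefect K (t.1 • x) / t.1

variable {K : Set E}

theorem covariogram_nonneg (x : E) : 0 ≤ covariogram K x := measureReal_nonneg

theorem volume_preimage_sub (x : E) (A : Set E) : volume ((fun y => y - x) ⁻¹' A) = volume A := by
  simpa only [sub_eq_add_neg] using measure_preimage_add_right volume (-x) A

theorem volume_ne_top_of_subset (hK : IsCompact K) {A : Set E} (hA : A ⊆ K) : volume A ≠ ∞ :=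
  ne_top_of_le_ne_top hK.measure_lt_top.ne (measure_mono hA)

theorem covariogram_add_covariogramDefect (hK : IsCompact K) (x : E) :
    covariogram K x + covariogramDefect K x = volume.real K :=
  measureReal_inter_add_sdiff (s := K) (hK.measurableSet.preimage (measurable_sub_const x))
    hK.measure_lt_top.ne

theorem covariogram_le (hK : IsCompact K) (x : E) : covariogram K x ≤ volume.real K :=
  measureReal_mono (fun _ hy => hy.1) hK.measure_lt_top.ne

theorem covariogram_neg (x : E) : covariogram K (-x) = covariogram K x := by
  unfold covariogram Measure.real
  rw [← measure_preimage_add_right volume x {y | y ∈ K ∧ y - x ∈ K}]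
  congr 2
  ext y
  simp [and_comm]

theorem covariogramDefect_neg (hK : IsCompact K) (x : E) :
    covariogramDefect K (-x) = covariogramDefect K x := by
  have h1 := covariogram_add_covariogramDefect hK x
  have h2 := covariogram_add_covariogramDefect hK (-x)
  rw [covariogram_neg] at h2
  linarith

theorem covariogramDefect_zero : covariogramDefect K 0 = 0 := by
  simp [covariogramDefect]

/-- A point that leaves K under subtraction of x + z leaves either on subtracting x or on then
subtracting z; the second event is a translate of the defect set of z. -/
theorem covariogramDefect_add_le (hK : IsCompact K) (x z : E) :
    covariogramDefect K (x + z) ≤ covariogramDefect K x + covariogramDefect K z := by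
  have h : volume.real {y | y - x ∈ K ∧ y - x - z ∉ K} = covariogramDefect K z := by
    unfold covariogramDefect Measure.real
    rw [← volume_preimage_sub x {y | y ∈ K ∧ y - z ∉ K}]
    rfl
  rw [← h]
  refine le_trans (measureReal_mono ?_ (measure_union_lt_top ?_ ?_).ne) (measureReal_union_le _ _)
  · rintro y ⟨hy, hy'⟩
    by_cases hx : y - x ∈ K
    · exact Or.inr ⟨hx, by rwa [sub_sub]⟩
    · exact Or.inl ⟨hy, hx⟩
  · exact (volume_ne_top_of_subset hK fun y hy => hy.1).lt_top
  · refine lt_of_le_of_lt (measure_mono (t := (fun y => y - x) ⁻¹' K) fun y hy => hy.1) ?_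
    rw [volume_preimage_sub]
    exact hK.measure_lt_top

theorem covariogramDefect_nsmul_le (hK : IsCompact K) (k : ℕ) (x : E) :
    covariogramDefect K ((k : ℝ) • x) ≤ k * covariogramDefect K x := by
  induction k with
  | zero => simp [covariogramDefect_zero]
  | succ k ih =>
    push_cast
    rw [add_smul, one_smul]
    linarith [covariogramDefect_add_le hK ((k : ℝ) • x) x]

/-- The `n`-th root of the normalized covariogram. -/
def covariogramRoot (K : Set E) (x : E) : ℝ :=
  (covariogram K x / volume.real K) ^ ((Module.finrank ℝ E : ℝ)⁻¹)

theorem covariogramRoot_nonneg (x : E) : 0 ≤ covariogramRoot K x :=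
  Real.rpow_nonneg (div_nonneg (covariogram_nonneg x) measureReal_nonneg) _

theorem covariogramRoot_pow (hn : 0 < Module.finrank ℝ E) (hK0 : 0 < volume.real K) (x : E) :
    volume.real K * covariogramRoot K x ^ Module.finrank ℝ E = covariogram K x := by
  rw [covariogramRoot, Real.rpow_inv_natCast_pow (div_nonneg (covariogram_nonneg x)
    measureReal_nonneg) hn.ne', mul_div_cancel₀ _ hK0.ne']

theorem covariogramRoot_le_one (hK : IsCompact K) (x : E) :
    covariogramRoot K x ≤ 1 :=
  Real.rpow_le_one (div_nonneg (covariogram_nonneg x) measureReal_nonneg)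
    (div_le_one_of_le₀ (covariogram_le hK x) measureReal_nonneg) (by positivity)

/-- The covariogram restricted to a ray has concave `n`-th root, by Brunn–Minkowski. -/
theorem le_covariogram_smul (hconv : Convex ℝ K) (hK : IsCompact K)
    (hn : 0 < Module.finrank ℝ E) (hK0 : 0 < volume.real K)
    {x : E} (hx : {y | y ∈ K ∧ y - x ∈ K}.Nonempty) {t : ℝ} (h0 : 0 < t) (h1 : t < 1) :
    volume.real K * (1 - t + t * covariogramRoot K x) ^ Module.finrank ℝ E ≤
      covariogram K (t • x) := by
  set n := Module.finrank ℝ E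
  set ρ := (volume.real K) ^ ((n : ℝ)⁻¹) with hρ
  have hρ0 : 0 < ρ := Real.rpow_pos_of_pos hK0 _
  have hρn : ρ ^ n = volume.real K := Real.rpow_inv_natCast_pow hK0.le hn.ne'
  have hr := covariogramRoot_nonneg (K := K) x
  have key := brunnMinkowski (a := 1 - t) (b := t) (α := ρ) (β := ρ * covariogramRoot K x)
    (by linarith) h0 hρ0 (by positivity) hK.measurableSet (measurableSet_inter_translate hK x)
    (measurableSet_inter_translate hK (t • x)) hx (by
      rw [hρn, Measure.real, ENNReal.ofReal_toReal hK.measure_lt_top.ne]) (by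
      rw [mul_pow, hρn, covariogramRoot_pow hn hK0, covariogram, Measure.real,
        ENNReal.ofReal_toReal (volume_ne_top_of_subset hK fun y hy => hy.1)]) (by
      -- Both (1-t)a + tb and its shift by -tx, which is (1-t)a + t(b - x), are convex combinations
      -- of points of K.
      rintro a ha b ⟨hb, hb'⟩
      refine ⟨hconv ha hb (by linarith) h0.le (by ring), ?_⟩
      have := hconv ha hb' (by linarith : 0 ≤ 1 - t) h0.le (by ring)
      convert this using 1
      module)
  rw [show (1 - t) * ρ + t * (ρ * covariogramRoot K x) = ρ * (1 - t + t * covariogramRoot K x)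
    by ring, mul_pow, hρn] at key
  exact (ENNReal.ofReal_le_iff_le_toReal
    (volume_ne_top_of_subset hK fun y hy => hy.1)).mp key

/-- For t < 1, Bernoulli's inequality linearizes the Brunn–Minkowski bound. Subadditivity of the
defect, applied to k copies of (t/k)x with k > t, removes the restriction on t. -/
theorem covariogramDefect_smul_le (hconv : Convex ℝ K) (hK : IsCompact K)
    (hn : 0 < Module.finrank ℝ E) (hK0 : 0 < volume.real K)
    {x : E} (hx : {y | y ∈ K ∧ y - x ∈ K}.Nonempty) {t : ℝ} (h0 : 0 < t) :
    covariogramDefect K (t • x) / t ≤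
      Module.finrank ℝ E * volume.real K * (1 - covariogramRoot K x) := by
  set n := Module.finrank ℝ E
  have hr0 := covariogramRoot_nonneg (K := K) x
  have hr1 := covariogramRoot_le_one hK x
  have small : ∀ s : ℝ, 0 < s → s < 1 → covariogramDefect K (s • x) ≤
      n * volume.real K * (1 - covariogramRoot K x) * s := by
    intro s hs0 hs1
    have h2 := le_covariogram_smul hconv hK hn hK0 hx hs0 hs1
    have h3 := one_add_mul_le_pow (a := -s * (1 - covariogramRoot K x)) (by nlinarith) n
    rw [show 1 + -s * (1 - covariogramRoot K x) = 1 - s + s * covariogramRoot K x by ring] at h3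
    have h4 := covariogram_add_covariogramDefect hK (s • x)
    have h5 := mul_le_mul_of_nonneg_left h3 hK0.le
    linarith
  obtain ⟨k, hk⟩ := exists_nat_gt t
  have hk0 : (0 : ℝ) < k := h0.trans hk
  have h1 := small (t / k) (by positivity) (by rwa [div_lt_one hk0])
  have h2 := covariogramDefect_nsmul_le hK k ((t / k) • x)
  rw [smul_smul, mul_div_cancel₀ _ hk0.ne'] at h2
  rw [div_le_iff₀ h0]
  calc _ ≤ _ := h2
    _ ≤ k * (n * volume.real K * (1 - covariogramRoot K x) * (t / k)) := by gcongr
    _ = _ := by field_simp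

theorem volume_real_pos_of_interior_nonempty (hK : IsCompact K) (hint : (interior K).Nonempty) :
    0 < volume.real K :=
  ENNReal.toReal_pos (Measure.measure_pos_of_nonempty_interior _ hint).ne' hK.measure_lt_top.ne

theorem bddAbove_covariogramDefect_div (hconv : Convex ℝ K) (hK : IsCompact K)
    (hint : (interior K).Nonempty) (hn : 0 < Module.finrank ℝ E) (x : E) :
    BddAbove (Set.range fun t : Set.Ioi (0 : ℝ) => covariogramDefect K (t.1 • x) / t.1) := by
  have hK0 := volume_real_pos_of_interior_nonempty hK hint
  obtain ⟨s, hs0, hs⟩ := exists_smul_translate_inter_nonempty hint x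
  refine ⟨Module.finrank ℝ E * volume.real K * (1 - covariogramRoot K (s • x)) / s, ?_⟩
  rintro _ ⟨⟨t, ht : 0 < t⟩, rfl⟩
  have := covariogramDefect_smul_le hconv hK hn hK0 hs (t := t / s) (by positivity)
  rw [smul_smul, div_mul_cancel₀ _ hs0.ne'] at this
  rw [le_div_iff₀ hs0]
  calc _ = covariogramDefect K (t • x) / (t / s) := by field_simp
    _ ≤ _ := this

theorem covariogramDefect_div_le_projectionBodyNorm (hconv : Convex ℝ K) (hK : IsCompact K)
    (hint : (interior K).Nonempty) (hn : 0 < Module.finrank ℝ E) (x : E) {t : ℝ} (ht : 0 < t) :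
    covariogramDefect K (t • x) / t ≤ projectionBodyNorm K x :=
  le_ciSup (bddAbove_covariogramDefect_div hconv hK hint hn x) ⟨t, ht⟩

theorem projectionBodyNorm_le_of_forall {x : E} {c : ℝ}
    (h : ∀ t : ℝ, 0 < t → covariogramDefect K (t • x) / t ≤ c) : projectionBodyNorm K x ≤ c := by
  have : Nonempty (Set.Ioi (0 : ℝ)) := ⟨⟨1, Set.mem_Ioi.mpr zero_lt_one⟩⟩
  exact ciSup_le fun t => h t.1 t.2

/-- The projection body norm as a seminorm. -/
def projectionBodySeminorm (K : Set E) (hconv : Convex ℝ K) (hK : IsCompact K)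
    (hint : (interior K).Nonempty) (hn : 0 < Module.finrank ℝ E) : Seminorm ℝ E :=
  Seminorm.ofSMulLE (projectionBodyNorm K) (by simp [projectionBodyNorm, covariogramDefect_zero])
    (fun x y => projectionBodyNorm_le_of_forall fun t ht => by
      have h1 := covariogramDefect_div_le_projectionBodyNorm hconv hK hint hn x ht
      have h2 := covariogramDefect_div_le_projectionBodyNorm hconv hK hint hn y ht
      have h3 := div_le_div_of_nonneg_right (covariogramDefect_add_le hK (t • x) (t • y)) ht.le
      rw [smul_add]
      rw [add_div] at h3
      linarith)
    (fun r x => projectionBodyNorm_le_of_forall fun t ht => by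
      rcases eq_or_ne r 0 with rfl | hr
      · simp [covariogramDefect_zero]
      have hr' : 0 < |r| := abs_pos.mpr hr
      have h1 := covariogramDefect_div_le_projectionBodyNorm hconv hK hint hn x (mul_pos ht hr')
      have h2 : covariogramDefect K (t • r • x) = covariogramDefect K ((t * |r|) • x) := by
        rw [smul_smul]
        rcases abs_choice r with h | h
        · rw [h]
        · rw [h, ← covariogramDefect_neg hK]
          congr 1
          module
      rw [h2, Real.norm_eq_abs]
      rw [div_le_iff₀ (by positivity)] at h1 ⊢
      linarith)

/-- The covariogram is at most `|K| (1 - N / (n |K|))₊ ^ n`, where `N` is the projection body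
norm. -/
theorem covariogram_le_one_sub_pow (hconv : Convex ℝ K) (hK : IsCompact K)
    (hint : (interior K).Nonempty) (hn : 0 < Module.finrank ℝ E) (x : E) :
    covariogram K x ≤ volume.real K *
      max 0 (1 - projectionBodyNorm K x / (Module.finrank ℝ E * volume.real K)) ^
        Module.finrank ℝ E := by
  have hK0 := volume_real_pos_of_interior_nonempty hK hint
  by_cases hx : {y | y ∈ K ∧ y - x ∈ K}.Nonempty
  · rw [← covariogramRoot_pow hn hK0]
    -- The supremum over t gives N(x) ≤ n|K|(1 - r) with r the normalized root at x; solving for r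
    -- is the claim.
    have h1 : projectionBodyNorm K x ≤ _ := projectionBodyNorm_le_of_forall fun t ht =>
      covariogramDefect_smul_le hconv hK hn hK0 hx ht
    have hr := covariogramRoot_nonneg (K := K) x
    gcongr
    refine le_max_of_le_right ?_
    have hn' : (0 : ℝ) < Module.finrank ℝ E := by exact_mod_cast hn
    rw [le_sub_comm, div_le_iff₀ (by positivity)]
    linarith
  · rw [covariogram, Set.not_nonempty_iff_eq_empty.mp hx, measureReal_empty]
    positivity

end Covariogram

end

/-! ### Shadows of K, chord lengths, and Cauchy–Schwarz over slices. -/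

section Projection

theorem exists_smul_add_orthogonalProjectionOnto {E : Type*} [NormedAddCommGroup E]
    [InnerProductSpace ℝ E] (u x : E) :
    ∃ s : ℝ, s • u + ((Submodule.span ℝ {u})ᗮ.orthogonalProjectionOnto x : E) = x := by
  have h := (Submodule.span ℝ {u})ᗮ.sub_starProjection_mem_orthogonal x
  rw [Submodule.orthogonal_orthogonal] at h
  obtain ⟨s, hs⟩ := Submodule.mem_span_singleton.mp h
  exact ⟨s, by rw [hs]; simp⟩

variable {E : Type*} [NormedAddCommGroup E] [InnerProductSpace ℝ E]
    [FiniteDimensional ℝ E]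

theorem Submodule.orthogonalProjectionOnto_orthogonal_add (W : Submodule ℝ E) {x : E} (hx : x ∈ W)
    (y : Wᗮ) : Wᗮ.orthogonalProjectionOnto (x + y) = y := by
  have hx' : x ∈ Wᗮᗮ := by rwa [Submodule.orthogonal_orthogonal]
  rw [map_add, Submodule.orthogonalProjectionOnto_apply_of_mem_orthogonal hx', zero_add,
    Submodule.orthogonalProjectionOnto_mem_subspace_eq_self]

variable [MeasurableSpace E] [BorelSpace E] {K : Set E}

/-- The shadow of K lies in the closure of the convex shadow of the interior, and the frontier of a
convex set is null. Chords of positive length are only guaranteed over interior points. -/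
theorem volume_projection_le_interior (hconv : Convex ℝ K)
    (hint : (interior K).Nonempty) (W : Submodule ℝ E) :
    volume (W.orthogonalProjectionOnto '' K) ≤
      volume (W.orthogonalProjectionOnto '' interior K) := by
  set P := W.orthogonalProjectionOnto
  have h1 : K ⊆ closure (interior K) := by
    rw [hconv.closure_interior_eq_closure_of_nonempty_interior hint]
    exact subset_closure
  have h2 : P '' K ⊆ closure (P '' interior K) :=
    (Set.image_mono h1).trans (image_closure_subset_closure_image P.continuous)
  refine (measure_mono h2).trans ?_
  rw [closure_eq_self_union_frontier]
  refine (measure_union_le _ _).trans ?_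
  have hc : Convex ℝ (P '' interior K) := hconv.interior.linear_image P.toLinearMap
  rw [hc.addHaar_frontier volume, add_zero]

theorem volume_projection_pos (hint : (interior K).Nonempty) (W : Submodule ℝ E) :
    0 < volume (W.orthogonalProjectionOnto '' K) := by
  refine lt_of_lt_of_le ?_ (measure_mono (Set.image_mono interior_subset))
  refine IsOpen.measure_pos _ ?_ (hint.image _)
  refine (W.orthogonalProjectionOnto.isOpenMap ?_) _ isOpen_interior
  intro y
  exact ⟨y, Submodule.orthogonalProjectionOnto_mem_subspace_eq_self y⟩

/-- The points of the shadow of `K` lying under a chord of `K` of length at least `t` have measure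
at most `|K \ (t u + K)| / t`. -/
theorem mul_volume_projection_inter_translate_le (hconv : Convex ℝ K) (hK : IsCompact K) {u : E}
    (hu : ‖u‖ = 1) (t : ℝ) :
    ENNReal.ofReal t * volume ((Submodule.span ℝ {u})ᗮ.orthogonalProjectionOnto ''
      {x | x ∈ K ∧ x + t • u ∈ K}) ≤ ENNReal.ofReal (covariogramDefect K (t • u)) := by
  set W := (Submodule.span ℝ {u})ᗮ
  set D : Set W := W.orthogonalProjectionOnto '' {x | x ∈ K ∧ x + t • u ∈ K} with hD
  have hDm : MeasurableSet D := by
    have : IsCompact {x | x ∈ K ∧ x + t • u ∈ K} :=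
      hK.inter_right (hK.isClosed.preimage (continuous_add_const (t • u)))
    exact (this.image W.orthogonalProjectionOnto.continuous).measurableSet
  have hpre := measurePreserving_smul_add_orthogonal hu
  have hm : MeasurableSet {y | y ∈ K ∧ y - t • u ∉ K} :=
    hK.measurableSet.inter (hK.measurableSet.preimage (measurable_sub_const _)).compl
  rw [covariogramDefect, Measure.real, ENNReal.ofReal_toReal
    (volume_ne_top_of_subset hK fun y hy => hy.1), ← hpre.measure_preimage hm.nullMeasurableSet,
    Measure.volume_eq_prod, Measure.prod_apply_symm (hpre.measurable hm),
    ← lintegral_indicator_const hDm]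
  refine lintegral_mono fun p => ?_
  by_cases hp : p ∈ D
  · rw [Set.indicator_of_mem hp]
    obtain ⟨x, ⟨hx, hxt⟩, rfl⟩ := hp
    obtain ⟨s, hs⟩ := exists_smul_add_orthogonalProjectionOnto u x
    set p := W.orthogonalProjectionOnto x
    set A : Set ℝ := {r | r • u + (p : E) ∈ K} with hA
    have hpcl : Topology.IsClosedEmbedding fun r : ℝ => r • u + (p : E) := by
      have h1 := LinearMap.isClosedEmbedding_of_injective (f := LinearMap.toSpanSingleton ℝ E u)
        (LinearMap.ker_toSpanSingleton ℝ (by rintro rfl; simp at hu))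
      exact (Homeomorph.addRight (p : E)).isClosedEmbedding.comp h1
    have hAc : IsCompact A := hpcl.isCompact_preimage hK
    have hsA : s ∈ A := by rw [hA, Set.mem_ofPred_eq, hs]; exact hx
    have hstA : s + t ∈ A := by
      rw [hA, Set.mem_ofPred_eq, show (s + t) • u + (p : E) = (s • u + p) + t • u by module, hs]
      exact hxt
    -- From the lower end m of the chord over p, the segment [m, m + t) stays in K, since m + t ≤ s
    -- + t, and its shift by -t misses K.
    obtain ⟨m, hmA, hmle⟩ := hAc.exists_isLeast ⟨s, hsA⟩
    have hAconv : ∀ r, m ≤ r → r ≤ s + t → r ∈ A := by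
      have : Convex ℝ A := by
        have h3 : A = (fun r => r • u) ⁻¹' ((fun x => x + (p : E)) ⁻¹' K) := rfl
        rw [h3]
        exact (hconv.translate_preimage_left _).linear_preimage (LinearMap.toSpanSingleton ℝ E u)
      intro r h1 h2
      exact this.ordConnected.out hmA hstA ⟨h1, h2⟩
    calc ENNReal.ofReal t = volume (Set.Ico m (m + t)) := by simp
      _ ≤ _ := by
        refine measure_mono fun r hr => ?_
        refine ⟨hAconv r hr.1 (by linarith [hr.2, hmle hsA]), fun hcon => ?_⟩
        have hcon' : r - t ∈ A := by
          rw [hA, Set.mem_ofPred_eq]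
          convert hcon using 1
          simp only
          module
        linarith [hmle hcon', hr.2]
  · rw [Set.indicator_of_notMem hp]
    exact zero_le

/-- The part of the shadow under chords of length at least τ has measure at most |K \ (τu + K)|/τ ≤
N(u). As τ decreases to 0 these parts increase and exhaust the shadow of the interior. -/
theorem volume_projection_le_projectionBodyNorm (hconv : Convex ℝ K) (hK : IsCompact K)
    (hint : (interior K).Nonempty) (hn : 0 < Module.finrank ℝ E) {u : E} (hu : ‖u‖ = 1) :
    volume ((Submodule.span ℝ {u})ᗮ.orthogonalProjectionOnto '' K) ≤
      ENNReal.ofReal (projectionBodyNorm K u) := by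
  set P := (Submodule.span ℝ {u})ᗮ.orthogonalProjectionOnto
  set τ : ℕ → ℝ := fun k => 1 / ((k : ℝ) + 1) with hτ
  have hτ0 : ∀ k, 0 < τ k := fun k => by positivity
  set D : ℕ → Set (Submodule.span ℝ {u})ᗮ := fun k => P '' {x | x ∈ K ∧ x + τ k • u ∈ K} with hD
  have hbound : ∀ k, volume (D k) ≤ ENNReal.ofReal (projectionBodyNorm K u) := by
    intro k
    have h1 := mul_volume_projection_inter_translate_le hconv hK hu (τ k)
    have h2 := covariogramDefect_div_le_projectionBodyNorm hconv hK hint hn u (hτ0 k)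
    rw [div_le_iff₀ (hτ0 k), mul_comm] at h2
    have h3 := h1.trans (ENNReal.ofReal_le_ofReal h2)
    rw [ENNReal.ofReal_mul (hτ0 k).le] at h3
    exact (ENNReal.mul_le_mul_iff_right (by simpa using hτ0 k) ENNReal.ofReal_ne_top).mp h3
  have hmono : Monotone D := by
    intro j k hjk
    refine Set.image_mono fun x hx => ⟨hx.1, ?_⟩
    have hle : τ k ≤ τ j := one_div_le_one_div_of_le (by positivity) (by gcongr)
    have := hconv.add_smul_mem hx.1 hx.2 (t := τ k / τ j)
      ⟨(div_pos (hτ0 k) (hτ0 j)).le, (div_le_one (hτ0 j)).mpr hle⟩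
    rwa [smul_smul, div_mul_cancel₀ _ (hτ0 j).ne'] at this
  refine (volume_projection_le_interior hconv hint _).trans ?_
  have hsub : P '' interior K ⊆ ⋃ k, D k := by
    rintro _ ⟨x, hx, rfl⟩
    have h1 : Filter.Tendsto (fun k => x + τ k • u) Filter.atTop (nhds x) := by
      simpa [hτ] using ((tendsto_one_div_add_atTop_nhds_zero_nat (𝕜 := ℝ)).smul_const u).const_add x
    obtain ⟨k, hk⟩ := (h1.eventually (mem_interior_iff_mem_nhds.mp hx)).exists
    exact Set.mem_iUnion.mpr ⟨k, x, ⟨interior_subset hx, hk⟩, rfl⟩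
  refine (measure_mono hsub).trans ?_
  rw [hmono.measure_iUnion]
  exact iSup_le hbound

theorem projectionBodyNorm_pos (hconv : Convex ℝ K) (hK : IsCompact K)
    (hint : (interior K).Nonempty) (hn : 0 < Module.finrank ℝ E) {x : E} (hx : x ≠ 0) :
    0 < projectionBodyNorm K x := by
  have hx' : 0 < ‖x‖ := norm_pos_iff.mpr hx
  have h1 : 0 < projectionBodyNorm K (‖x‖⁻¹ • x) := by
    have := (volume_projection_pos hint _).trans_le
      (volume_projection_le_projectionBodyNorm hconv hK hint hn (u := ‖x‖⁻¹ • x)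
        (by simp [norm_smul, hx'.ne']))
    simpa using this
  have h2 : projectionBodyNorm K (‖x‖⁻¹ • x) = ‖x‖⁻¹ * projectionBodyNorm K x := by
    have := map_smul_eq_mul (projectionBodySeminorm K hconv hK hint hn) ‖x‖⁻¹ x
    rw [norm_inv, norm_norm] at this
    exact this
  rw [h2] at h1
  exact (pos_iff_pos_of_mul_pos h1).mp (by positivity)

/-- With m(y) the volume of the slice of K over y, Fubini gives ∫ m = |K| and ∫ m² = ∫_H g, the
latter by autocorrelating each slice. Since m vanishes off the shadow, Cauchy–Schwarz against its
indicator concludes. -/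
theorem sq_volume_le_mul_lintegral_covariogram (hK : IsCompact K) (H : Submodule ℝ E) :
    volume K ^ 2 ≤ volume (Hᗮ.orthogonalProjectionOnto '' K) *
      ∫⁻ h : H, ENNReal.ofReal (covariogram K (h : E)) := by
  set D := Hᗮ.orthogonalProjectionOnto '' K with hD
  have hDm : MeasurableSet D :=
    (hK.image Hᗮ.orthogonalProjectionOnto.continuous).measurableSet
  have hpre := H.measurePreserving_add_orthogonal
  have hKm := hK.measurableSet
  set κ : E → ℝ≥0∞ := K.indicator 1 with hκ
  have hκm : Measurable κ := measurable_one.indicator hKm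
  set m : Hᗮ → ℝ≥0∞ := fun y => ∫⁻ z : H, κ (z + y) with hm
  have hmm : Measurable m := by
    have : Measurable fun p : Hᗮ × H => κ ((p.2 : E) + p.1) := by fun_prop
    exact this.lintegral_prod_right'
  have hvol : volume K = ∫⁻ y, m y := by
    rw [← lintegral_indicator_one hKm, ← hpre.lintegral_comp hκm, Measure.volume_eq_prod]
    exact lintegral_prod_symm _ (hκm.comp hpre.measurable).aemeasurable
  have hmD : ∀ y, y ∉ D → m y = 0 := by
    intro y hy
    have : ∀ z : H, κ (z + y) = 0 := fun z => by
      refine Set.indicator_of_notMem (fun hz => hy ⟨_, hz, ?_⟩) _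
      exact H.orthogonalProjectionOnto_orthogonal_add z.2 y
    simp [hm, this]
  have hcov : ∫⁻ h : H, ENNReal.ofReal (covariogram K (h : E)) = ∫⁻ y, m y ^ 2 := by
    have h1 : ∀ h : H, ENNReal.ofReal (covariogram K (h : E)) =
        ∫⁻ y : Hᗮ, ∫⁻ z : H, κ (z + y) * κ (z + y - h) := by
      intro h
      rw [covariogram, Measure.real, ENNReal.ofReal_toReal
        (volume_ne_top_of_subset hK fun y hy => hy.1), ← lintegral_indicator_one
        (measurableSet_inter_translate hK _)]
      have e : ({y | y ∈ K ∧ y - (h : E) ∈ K}.indicator 1 : E → ℝ≥0∞) =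
          fun x => κ x * κ (x - h) := by
        funext x
        by_cases h1 : x ∈ K <;> by_cases h2 : x - (h : E) ∈ K <;> simp [hκ, h1, h2]
      have hme : Measurable fun x => κ x * κ (x - h) := by fun_prop
      rw [e, ← hpre.lintegral_comp hme, Measure.volume_eq_prod]
      exact lintegral_prod_symm _ (hme.comp hpre.measurable).aemeasurable
    simp_rw [h1]
    rw [lintegral_lintegral_swap]
    · refine lintegral_congr fun y => ?_
      rw [lintegral_lintegral_swap (by
        refine Measurable.aemeasurable ?_
        simp only [Function.uncurry_def]
        fun_prop)]
      have h2 : ∀ z : H, ∫⁻ h : H, κ (z + y) * κ (z + y - h) = κ (z + y) * m y := by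
        intro z
        rw [lintegral_const_mul _ (by fun_prop)]
        congr 1
        simp only [hm]
        -- The substitution h ↦ z - h turns the inner integral into m(y), independently of z.
        rw [← lintegral_sub_left_eq_self (fun h : H => κ (h + y)) z]
        refine lintegral_congr fun h => ?_
        congr 1
        push_cast
        abel
      simp_rw [h2]
      rw [lintegral_mul_const _ (by fun_prop), sq]
    · have : Measurable fun q : (H × Hᗮ) × H =>
          κ ((q.2 : E) + q.1.2) * κ ((q.2 : E) + q.1.2 - q.1.1) := by fun_prop
      exact this.lintegral_prod_right'.aemeasurable
  have hCS := ENNReal.lintegral_mul_le_Lp_mul_Lq (volume : Measure Hᗮ)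
    Real.HolderConjugate.two_two (f := D.indicator 1) (g := m)
    (measurable_one.indicator hDm).aemeasurable hmm.aemeasurable
  have e1 : ∀ y, ((D.indicator 1 : Hᗮ → ℝ≥0∞) * m) y = m y := by
    intro y
    by_cases hy : y ∈ D
    · simp [hy]
    · simp [hmD y hy]
  have e2 : ∀ y, (D.indicator (1 : Hᗮ → ℝ≥0∞) y) ^ (2 : ℝ) = D.indicator 1 y := by
    intro y
    by_cases hy : y ∈ D <;> simp [hy]
  simp_rw [e1, e2, lintegral_indicator_one hDm, ENNReal.rpow_two] at hCS
  rw [hcov, hvol]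
  calc (∫⁻ y, m y) ^ 2 ≤ (volume D ^ (1 / 2 : ℝ) * (∫⁻ y, m y ^ 2) ^ (1 / 2 : ℝ)) ^ 2 := by
        gcongr
    _ = _ := by
        rw [mul_pow, ← ENNReal.rpow_mul_natCast, ← ENNReal.rpow_mul_natCast]
        norm_num

end Projection

/-! ### The main inequality. -/

theorem projectionVolume_eq {n : ℕ} (W : Submodule ℝ (EuclideanSpace ℝ (Fin n)))
    (K : Set (EuclideanSpace ℝ (Fin n))) :
    projectionVolume W K = volume.real (W.orthogonalProjectionOnto '' K) := by
  rw [projectionVolume, OrthonormalBasis.addHaar_eq_volume]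

theorem theorem1p3 (n d : ℕ) (hd : 2 ≤ d) (hdn : d ≤ n - 1)
    (K : Set (EuclideanSpace ℝ (Fin n)))
    (hKconvex : Convex ℝ K) (hKcompact : IsCompact K) (hKinterior : (interior K).Nonempty)
    (H : Submodule ℝ (EuclideanSpace ℝ (Fin n))) (hH : Module.finrank ℝ H = d) :
    ∃ w : OrthonormalBasis (Fin d) ℝ H,
      projectionVolume Hᗮ K * (volume.real K) ^ (d - 1) ≥
        (((n + d).choose n : ℝ) / (2 * (n : ℝ)) ^ d) *
          ∏ i : Fin d, projectionVolume (Submodule.span ℝ {(w i : EuclideanSpace ℝ (Fin n))})ᗮ K := by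
  have hE : Module.finrank ℝ (EuclideanSpace ℝ (Fin n)) = n := finrank_euclideanSpace_fin
  have hn0 : 0 < n := by omega
  have hn : 0 < Module.finrank ℝ (EuclideanSpace ℝ (Fin n)) := by rwa [hE]
  have hn' : (0 : ℝ) < n := by exact_mod_cast hn0
  have hv := volume_real_pos_of_interior_nonempty hKcompact hKinterior
  set v := volume.real K with hv_def
  set N := projectionBodySeminorm K hKconvex hKcompact hKinterior hn
  have hN : ∀ x, N x = projectionBodyNorm K x := fun _ => rfl
  set NH : Seminorm ℝ H := N.comp H.subtype
  obtain ⟨w, hw⟩ := NH.exists_orthonormalBasis_volume_unitBall_mul_prod_le d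
    (fun x hx => projectionBodyNorm_pos hKconvex hKcompact hKinterior hn
      (x := (x : EuclideanSpace ℝ (Fin n))) (by simpa using hx)) hH
  refine ⟨w, ?_⟩
  have hwle : ∀ i, projectionVolume (Submodule.span ℝ {(w i : EuclideanSpace ℝ (Fin n))})ᗮ K ≤
      NH (w i) := by
    intro i
    rw [projectionVolume_eq]
    refine ENNReal.toReal_le_of_le_ofReal (apply_nonneg _ _)
      (volume_projection_le_projectionBodyNorm hKconvex hKcompact hKinterior hn ?_)
    exact w.orthonormal.1 i
  set p := projectionVolume Hᗮ K with hp
  have hp0 : 0 ≤ p := measureReal_nonneg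
  have hpv : volume (Hᗮ.orthogonalProjectionOnto '' K) = ENNReal.ofReal p := by
    rw [hp, projectionVolume_eq, Measure.real, ENNReal.ofReal_toReal]
    exact (hKcompact.image Hᗮ.orthogonalProjectionOnto.continuous).measure_lt_top.ne
  have hKv : volume K = ENNReal.ofReal v := by
    rw [hv_def, Measure.real, ENNReal.ofReal_toReal hKcompact.measure_lt_top.ne]
  have hsq := sq_volume_le_mul_lintegral_covariogram hKcompact H
  have hcov : ∫⁻ h : H, ENNReal.ofReal (covariogram K (h : EuclideanSpace ℝ (Fin n))) ≤
      ENNReal.ofReal v * (ENNReal.ofReal ((n * v) ^ d / (n + d).choose n) *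
        volume {x | NH x ≤ 1}) := by
    -- The exponent n comes from the ambient space, while the integration runs over H, of dimension
    -- d.
    have h1 := NH.lintegral_one_sub_pow_le (M := n * v) (by positivity) hn0
    rw [hH] at h1
    refine le_trans ?_ (mul_le_mul_right h1 _)
    rw [← lintegral_const_mul' _ _ ENNReal.ofReal_ne_top]
    refine lintegral_mono fun h => ?_
    rw [← ENNReal.ofReal_mul hv.le]
    refine ENNReal.ofReal_le_ofReal ?_
    have h2 := covariogram_le_one_sub_pow hKconvex hKcompact hKinterior hn
      (h : EuclideanSpace ℝ (Fin n))
    rwa [hE] at h2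
  have hC : (0 : ℝ) < (n + d).choose n := by exact_mod_cast Nat.choose_pos (by omega)
  have hQ0 : 0 ≤ ∏ i, NH (w i) := Finset.prod_nonneg fun i _ => apply_nonneg _ _
  -- Multiplying the Cauchy–Schwarz bound by ∏ N(w_i) trades the unknown volume of the unit ball for
  -- 2^d.
  have hmain : v ^ 2 * ∏ i, NH (w i) ≤ p * (v * ((n * v) ^ d / (n + d).choose n * 2 ^ d)) := by
    rw [← ENNReal.ofReal_le_ofReal_iff (by positivity), ENNReal.ofReal_mul (by positivity),
      ENNReal.ofReal_pow hv.le, ENNReal.ofReal_prod_of_nonneg fun i _ => apply_nonneg _ _,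
      ENNReal.ofReal_mul hp0, ENNReal.ofReal_mul hv.le,
      ENNReal.ofReal_mul (q := 2 ^ d) (by positivity), ENNReal.ofReal_pow zero_le_two,
      ENNReal.ofReal_ofNat, ← hKv, ← hpv]
    calc _ ≤ (volume (Hᗮ.orthogonalProjectionOnto '' K) * (ENNReal.ofReal v *
            (ENNReal.ofReal ((n * v) ^ d / (n + d).choose n) * volume {x | NH x ≤ 1}))) *
            ∏ i, ENNReal.ofReal (NH (w i)) := by
          gcongr
          exact hsq.trans (by gcongr)
      _ = volume (Hᗮ.orthogonalProjectionOnto '' K) * (ENNReal.ofReal v *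
            (ENNReal.ofReal ((n * v) ^ d / (n + d).choose n) * (volume {x | NH x ≤ 1} *
            ∏ i, ENNReal.ofReal (NH (w i))))) := by ring
      _ ≤ _ := by
          rw [hKv]
          gcongr
  have hprod : ∏ i, projectionVolume (Submodule.span ℝ {(w i : EuclideanSpace ℝ (Fin n))})ᗮ K ≤
      ∏ i, NH (w i) := Finset.prod_le_prod (fun i _ => measureReal_nonneg) fun i _ => hwle i
  rw [ge_iff_le, div_mul_eq_mul_div, div_le_iff₀ (by positivity)]
  refine (mul_le_mul_of_nonneg_left hprod hC.le).trans ?_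
  obtain ⟨e, rfl⟩ : ∃ e, d = e + 1 := ⟨d - 1, by omega⟩
  rw [Nat.add_sub_cancel]
  -- Since v (nv)^(e+1) = v² · n^(e+1) v^e, a factor v² cancels and leaves v^(d-1).
  have h3 : v ^ 2 * (((n + (e + 1)).choose n : ℝ) * ∏ i, NH (w i)) ≤
      v ^ 2 * (p * v ^ e * (2 * n) ^ (e + 1)) := by
    calc _ = ((n + (e + 1)).choose n : ℝ) * (v ^ 2 * ∏ i, NH (w i)) := by ring
      _ ≤ ((n + (e + 1)).choose n : ℝ) *
          (p * (v * ((n * v) ^ (e + 1) / (n + (e + 1)).choose n * 2 ^ (e + 1)))) := by gcongr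
      _ = _ := by
        field_simp
        ring
  exact le_of_mul_le_mul_left h3 (by positivity)
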